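/- Let $d\ge 1$, let $U\subseteq\mathbb{R}^d$ be non-empty and open, let $\sigma\ge 1$, and let $\mathcal{N}=\{N^{(x)}:x>0\}$ be a weight matrix, i.e. a family of sequences $N^{(x)}=(N^{(x)}_j)_{j\in\mathbb{N}}$ of positive reals with $N^{(x)}_j\le N^{(y)}_j$ for all $0<x\le y$ and all $j\in\mathbb{N}$. Assume that, for every $x>0$, the sequence $N=N^{(x)}$ is - normalized, $1=N_0\le N_1$; log-convex, $N_j^2\le N_{j-1}N_{j+1}$ for all $j\ge 1$; and such that $\lim_{j\to\infty}(N_j)^{1/j}=\infty$ (that is, $\mathcal{N}$ is standard log-convex); - non-quasianalytic, $\sum_{j\ge 1} N_{j-1}/N_j<\infty$. Let $\mathcal{E}(U)$ be the space of smooth complex-valued functions on $U$, and for $\tau>0$ put (with $0^0:=1$) $$\mathcal{E}_{\{\tau,\sigma\}}(U):=\Big\{f\in\mathcal{E}(U):\ \forall K\subseteq U\text{ compact}\ \exists h>0:\ \sup_{\alpha\in\mathbb{N}^d,\,x\in K}\frac{|f^{(\alpha)}(x)|}{h^{|\alpha|^{\sigma}}\,|\alpha|^{\tau|\alpha|^{\sigma}}}<\infty\Big\},$$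 $$\mathcal{E}_{\infty,\sigma}(U):=\bigcup_{\tau>0}\mathcal{E}_{\{\tau,\sigma\}}(U),$$ $$\mathcal{E}_{\{\mathcal{N}\}}(U):=\Big\{f\in\mathcal{E}(U):\ \forall K\subseteq U\text{ compact}\ \exists x>0\ \exists h>0:\ \sup_{\alpha\in\mathbb{N}^d,\,y\in K}\frac{|f^{(\alpha)}(y)|}{h^{|\alpha|}\,N^{(x)}_{|\alpha|}}<\infty\Big\}.$$ If $\mathcal{E}_{\infty,\sigma}(U)\subseteq\mathcal{E}_{\{\mathcal{N}\}}(U)$, then the inclusion is strict: $\mathcal{E}_{\infty,\sigma}(U)\subsetneq\mathcal{E}_{\{\mathcal{N}\}}(U)$. -/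

import Mathlib

open scoped ContDiff ENNReal

noncomputable section

namespace PTT

/-- `d`-dimensional Euclidean space. -/
abbrev Space (d : ℕ) : Type := EuclideanSpace ℝ (Fin d)

/-! ### Weight sequences -/

/-- The quotients `μ_j = M_j / M_{j-1}` for `j ≥ 1`, and `μ_0 = 1`. -/
def quotientSeq (M : ℕ → ℝ) : ℕ → ℝ
  | 0 => 1
  | j + 1 => M (j + 1) / M j

/-- The set `LC`: positive sequences that are normalized (`1 = M_0 ≤ M_1`), log-convex and
satisfy `(M_j)^{1/j} → ∞`. -/
structure IsLC (M : ℕ → ℝ) : Prop where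
  pos : ∀ j, 0 < M j
  zero_eq_one : M 0 = 1
  one_le_one : 1 ≤ M 1
  logConvex : ∀ j, 1 ≤ j → M j ^ 2 ≤ M (j - 1) * M (j + 1)
  tendsto_root : Filter.Tendsto (fun j : ℕ => M j ^ (1 / (j : ℝ))) Filter.atTop Filter.atTop

/-- Non-quasianalyticity of a sequence: `∑_{j ≥ 1} 1 / μ_j < ∞`. -/
def SeqNonQuasianalytic (M : ℕ → ℝ) : Prop :=
  Summable fun j : ℕ => 1 / quotientSeq M (j + 1)

/-! ### Weight matrices, with index set `ℝ_{>0}` -/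

/-- A weight matrix: a family `N^{(x)}`, `x > 0`, of sequences of positive reals that is
pointwise nondecreasing in `x`. -/
structure WeightMatrix where
  seq : {x : ℝ // 0 < x} → ℕ → ℝ
  pos : ∀ x j, 0 < seq x j
  mono : ∀ x y, x ≤ y → ∀ j, seq x j ≤ seq y j

/-- Standard log-convexity: every sequence of the matrix belongs to `LC`. -/
def WeightMatrix.StandardLogConvex (N : WeightMatrix) : Prop :=
  ∀ x, IsLC (N.seq x)

/-- Every sequence of the matrix is non-quasianalytic. -/
def WeightMatrix.NonQuasianalytic (N : WeightMatrix) : Prop :=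
  ∀ x, SeqNonQuasianalytic (N.seq x)

/-! ### Ultradifferentiable classes -/

/-- The partial derivative `∂f/∂x_i`. -/
def partialDeriv {d : ℕ} (i : Fin d) (f : Space d → ℂ) : Space d → ℂ :=
  fun x => fderiv ℝ f x (EuclideanSpace.single i 1)

/-- The partial derivative `f^{(α)}` for a multi-index `α ∈ ℕ^d`. -/
def multiDeriv {d : ℕ} (α : Fin d → ℕ) (f : Space d → ℂ) : Space d → ℂ :=
  (List.finRange d).foldr (fun i g => (partialDeriv i)^[α i] g) f

/-- The length `|α|` of a multi-index. -/
def multiLength {d : ℕ} (α : Fin d → ℕ) : ℕ := ∑ i, α i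

/-- The seminorm `sup_{α ∈ ℕ^d, x ∈ K} |f^{(α)}(x)| / (h^{Φ_{|α|}} M_{|α|})`, with values
in `[0, ∞]`. -/
def weightSeminorm {d : ℕ} (M Φ : ℕ → ℝ) (K : Set (Space d)) (h : ℝ) (f : Space d → ℂ) :
    ℝ≥0∞ :=
  ⨆ α : Fin d → ℕ, ⨆ x ∈ K,
    ENNReal.ofReal (‖multiDeriv α f x‖ / (h ^ Φ (multiLength α) * M (multiLength α)))

/-- The Roumieu class `E_{N}(U)` of a weight matrix: smooth complex-valued functions on the
open set `U` such that for every compact `K ⊆ U` there are an index `x > 0` and an `h > 0` with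
`sup_{α, K} |f^{(α)}| / (h^{|α|} N^{(x)}_{|α|}) < ∞`.

A function on `U` is represented by any function on the whole space that extends it; the
condition only involves the restriction to the open set `U`. -/
def roumieuClass {d : ℕ} (N : WeightMatrix) (U : Set (Space d)) : Set (Space d → ℂ) :=
  {f | ContDiffOn ℝ ∞ f U ∧
    ∀ K : Set (Space d), IsCompact K → K ⊆ U →
      ∃ x : {x : ℝ // 0 < x}, ∃ h : ℝ, 0 < h ∧
        weightSeminorm (N.seq x) (fun j => (j : ℝ)) K h f < ⊤}

/-- The sequence `M^{τ,σ}_j = j^{τ j^σ}`, with `0^0 = 1`. -/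
def pttSeq (τ σ : ℝ) (j : ℕ) : ℝ := (j : ℝ) ^ (τ * (j : ℝ) ^ σ)

/-- The class `E_{τ,σ}(U)` of Roumieu type: smooth functions on `U` such that for every
compact `K ⊆ U` there is an `h > 0` with
`sup_{α, K} |f^{(α)}| / (h^{|α|^σ} |α|^{τ |α|^σ}) < ∞`. -/
def pttClass {d : ℕ} (τ σ : ℝ) (U : Set (Space d)) : Set (Space d → ℂ) :=
  {f | ContDiffOn ℝ ∞ f U ∧
    ∀ K : Set (Space d), IsCompact K → K ⊆ U →
      ∃ h : ℝ, 0 < h ∧ weightSeminorm (pttSeq τ σ) (fun j => (j : ℝ) ^ σ) K h f < ⊤}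

/-- The limit class `E_{∞,σ}(U) = ⋃_{τ > 0} E_{τ,σ}(U)`: the parameter `τ` is uniform in the
compact subsets of `U`. -/
def pttLimitClass {d : ℕ} (σ : ℝ) (U : Set (Space d)) : Set (Space d → ℂ) :=
  {f | ∃ τ : ℝ, 0 < τ ∧ f ∈ pttClass τ σ U}

end PTT

end

/-! The limit class asks for one `τ` serving all compact sets, whereas in the Roumieu class of the
matrix both `x` and `h` may depend on the compact set. Hence a function that is locally in the limit
class, but needs ever larger `τ` towards the boundary of `U` or infinity, separates the two classes.

Such a function is a sum of bumps `f n`, supported in disjoint balls in `U` that eventually leave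
every compact subset (`exists_seq_closedBall`). Each bump lies in the limit class, but its
derivatives of order `k` at the centre reach a fixed multiple of `2^{-k} k^{(n+1) k^σ}`
(`exists_spaceClass_bump`). Near a compact set the sum is a finite partial sum, so the assumed
inclusion provides the matrix estimate there. A uniform `τ ≤ n` is refuted at the centre of the
`n`-th ball (`exists_lt_pttSeq`).

In one variable the bump is a cut-off built from `exp(-1/t)` times a lacunary exponential series,
whose derivatives at the origin add up without cancellation. Tensor products of its translates give
the bumps on `ℝ^d`. -/

noncomputable section

namespace PTT

/-! ### Growth factors -/

/-- The growth factor `(k + 2)^{a k^σ}`. -/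
def growth (σ a : ℝ) (k : ℕ) : ℝ := ((k : ℝ) + 2) ^ (a * (k : ℝ) ^ σ)

theorem growth_pos (σ a : ℝ) (k : ℕ) : 0 < growth σ a k :=
  Real.rpow_pos_of_pos (by positivity) _

/-- The shift by 2 keeps the base above 1 even at order 0, so a larger exponent always gives a
larger factor. -/
theorem growth_le_growth {σ a b : ℝ} {k l : ℕ} (hσ : 0 ≤ σ) (ha : 0 ≤ a) (hab : a ≤ b)
    (hkl : k ≤ l) : growth σ a k ≤ growth σ b l := by
  have h0 : (0 : ℝ) ≤ k := k.cast_nonneg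
  have hl : (k : ℝ) ≤ l := by exact_mod_cast hkl
  unfold growth
  calc ((k : ℝ) + 2) ^ (a * (k : ℝ) ^ σ) ≤ ((l : ℝ) + 2) ^ (a * (k : ℝ) ^ σ) :=
        Real.rpow_le_rpow (by positivity) (by linarith) (by positivity)
    _ ≤ _ := Real.rpow_le_rpow_of_exponent_le (by linarith)
        (mul_le_mul hab (Real.rpow_le_rpow h0 hl hσ) (by positivity) (ha.trans hab))

theorem one_le_growth {σ a : ℝ} (ha : 0 ≤ a) (k : ℕ) : 1 ≤ growth σ a k :=
  Real.one_le_rpow (by linarith [(k.cast_nonneg : (0 : ℝ) ≤ k)]) (by positivity)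

theorem growth_mul_growth (σ a b : ℝ) (k : ℕ) :
    growth σ a k * growth σ b k = growth σ (a + b) k := by
  unfold growth
  rw [← Real.rpow_add (by positivity), add_mul]

/-- Superadditivity of `t ↦ t^σ` makes growth factors supermultiplicative. -/
theorem growth_mul_le {σ a b : ℝ} (hσ : 1 ≤ σ) (ha : 0 ≤ a) (hab : a ≤ b) (k l : ℕ) :
    growth σ a k * growth σ a l ≤ growth σ b (k + l) := by
  have h0 : (0 : ℝ) ≤ k := k.cast_nonneg
  have h0' : (0 : ℝ) ≤ l := l.cast_nonneg
  refine le_trans ?_ (growth_le_growth (by linarith) ha hab le_rfl)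
  unfold growth
  push_cast
  calc ((k : ℝ) + 2) ^ (a * (k : ℝ) ^ σ) * ((l : ℝ) + 2) ^ (a * (l : ℝ) ^ σ)
      ≤ ((k : ℝ) + l + 2) ^ (a * (k : ℝ) ^ σ) * ((k : ℝ) + l + 2) ^ (a * (l : ℝ) ^ σ) := by
        gcongr <;> linarith
    _ = ((k : ℝ) + l + 2) ^ (a * ((k : ℝ) ^ σ + (l : ℝ) ^ σ)) := by
        rw [← Real.rpow_add (by positivity), mul_add]
    _ ≤ _ := by
        apply Real.rpow_le_rpow_of_exponent_le (by linarith)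
        gcongr
        exact Real.add_rpow_le_rpow_add h0 h0' hσ

theorem natCast_le_rpow {σ : ℝ} (hσ : 1 ≤ σ) (k : ℕ) : (k : ℝ) ≤ (k : ℝ) ^ σ := by
  rcases Nat.eq_zero_or_pos k with rfl | hk
  · simpa using Real.rpow_nonneg le_rfl σ
  · exact Real.self_le_rpow_of_one_le (by exact_mod_cast hk) hσ

theorem pow_mul_le_growth {σ : ℝ} (hσ : 1 ≤ σ) (m k : ℕ) :
    ((k : ℝ) + 2) ^ (m * k) ≤ growth σ m k := by
  unfold growth
  rw [← Real.rpow_natCast]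
  apply Real.rpow_le_rpow_of_exponent_le (by linarith [(k.cast_nonneg : (0 : ℝ) ≤ k)])
  push_cast
  gcongr
  exact natCast_le_rpow hσ k

theorem two_pow_le_growth {σ : ℝ} (hσ : 1 ≤ σ) (k : ℕ) : (2 : ℝ) ^ k ≤ growth σ 1 k := by
  have h := pow_mul_le_growth hσ 1 k
  rw [one_mul, Nat.cast_one] at h
  refine le_trans ?_ h
  gcongr
  linarith [(k.cast_nonneg : (0 : ℝ) ≤ k)]

/-! ### Smooth functions of one variable with derivatives of controlled growth -/

/-- Smooth functions on the line whose `k`-th derivatives are uniformly `O((k + 2)^{a k^σ})`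
for some `a`. -/
structure LineClass (σ : ℝ) (φ : ℝ → ℂ) : Prop where
  contDiff : ContDiff ℝ ∞ φ
  bound : ∃ a C : ℝ, 0 ≤ a ∧ 0 ≤ C ∧ ∀ k t, ‖iteratedDeriv k φ t‖ ≤ C * growth σ a k

/-- Leibniz rule: supermultiplicativity bounds each product of growth factors, and the binomial sum
`2^k` costs one unit in the exponent. -/
theorem LineClass.mul {σ : ℝ} (hσ : 1 ≤ σ) {φ ψ : ℝ → ℂ} (hφ : LineClass σ φ)
    (hψ : LineClass σ ψ) : LineClass σ (fun t => φ t * ψ t) := by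
  obtain ⟨a, C, ha, hC, hφb⟩ := hφ.bound
  obtain ⟨b, D, hb, hD, hψb⟩ := hψ.bound
  refine ⟨hφ.contDiff.mul hψ.contDiff, 1 + max a b, C * D, by positivity, by positivity,
    fun k t => ?_⟩
  rw [← norm_iteratedFDeriv_eq_norm_iteratedDeriv]
  have hk : ((k : ℕ∞) : WithTop ℕ∞) ≤ (∞ : WithTop ℕ∞) := by exact_mod_cast le_top
  refine (norm_iteratedFDeriv_mul_le hφ.contDiff hψ.contDiff t hk).trans ?_
  calc _ ≤ ∑ i ∈ Finset.range (k + 1), (k.choose i : ℝ) * (C * D * growth σ (max a b) k) := by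
        apply Finset.sum_le_sum
        intro i hi
        have hik : i + (k - i) = k := by
          have := Finset.mem_range.1 hi
          omega
        rw [mul_assoc]
        refine mul_le_mul_of_nonneg_left ?_ (by positivity)
        rw [norm_iteratedFDeriv_eq_norm_iteratedDeriv, norm_iteratedFDeriv_eq_norm_iteratedDeriv]
        calc _ ≤ (C * growth σ a i) * (D * growth σ b (k - i)) :=
              mul_le_mul (hφb i t) (hψb _ t) (norm_nonneg _)
                (mul_nonneg hC (growth_pos _ _ _).le)
          _ ≤ (C * growth σ (max a b) i) * (D * growth σ (max a b) (k - i)) := by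
              have h1 := growth_le_growth (σ := σ) (by linarith) ha (le_max_left a b) (le_refl i)
              have h2 := growth_le_growth (σ := σ) (by linarith) hb (le_max_right a b)
                (le_refl (k - i))
              have h3 := growth_pos σ b (k - i)
              have h4 := growth_pos σ (max a b) i
              gcongr
          _ = C * D * (growth σ (max a b) i * growth σ (max a b) (k - i)) := by ring
          _ ≤ C * D * growth σ (max a b) k := by
              have := growth_mul_le hσ (le_max_of_le_left ha) (le_refl (max a b)) i (k - i)
              rw [hik] at this
              gcongr
    _ = C * D * (2 ^ k * growth σ (max a b) k) := by
        rw [← Finset.sum_mul, ← Nat.cast_sum, Nat.sum_range_choose]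
        push_cast
        ring
    _ ≤ C * D * growth σ (1 + max a b) k := by
        rw [← growth_mul_growth]
        have := two_pow_le_growth hσ k
        have := growth_pos σ (max a b) k
        gcongr

theorem LineClass.comp_const_sub {σ : ℝ} {φ : ℝ → ℂ} (hφ : LineClass σ φ) (r : ℝ) :
    LineClass σ (fun t => φ (r - t)) := by
  obtain ⟨a, C, ha, hC, hb⟩ := hφ.bound
  refine ⟨hφ.contDiff.comp (contDiff_const.sub contDiff_id), a, C, ha, hC, fun k t => ?_⟩
  rw [iteratedDeriv_comp_const_sub]
  simpa [norm_smul] using hb k (r - t)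

theorem LineClass.comp_sub_const {σ : ℝ} {φ : ℝ → ℂ} (hφ : LineClass σ φ) (r : ℝ) :
    LineClass σ (fun t => φ (t - r)) := by
  obtain ⟨a, C, ha, hC, hb⟩ := hφ.bound
  refine ⟨hφ.contDiff.comp (contDiff_id.sub contDiff_const), a, C, ha, hC, fun k t => ?_⟩
  rw [iteratedDeriv_comp_sub_const]
  exact hb k (t - r)

theorem LineClass.of_hasDerivAt {σ : ℝ} (hσ : 1 ≤ σ) {φ ψ : ℝ → ℂ} (hψ : LineClass σ ψ)
    (hd : ∀ t, HasDerivAt φ (ψ t) t) {B : ℝ} (hB : ∀ t, ‖φ t‖ ≤ B) : LineClass σ φ := by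
  obtain ⟨a, C, ha, hC, hb⟩ := hψ.bound
  have hderiv : deriv φ = ψ := funext fun t => (hd t).deriv
  have hB0 : 0 ≤ B := (norm_nonneg _).trans (hB 0)
  refine ⟨contDiff_infty_iff_deriv.2 ⟨fun t => (hd t).differentiableAt, hderiv ▸ hψ.contDiff⟩,
    a, max B C, ha, by positivity, fun k t => ?_⟩
  have hg := (growth_pos σ a k).le
  cases k with
  | zero =>
    rw [iteratedDeriv_zero]
    calc ‖φ t‖ ≤ max B C * 1 := by simpa using Or.inl (hB t)
      _ ≤ _ := by
        gcongr
        exact one_le_growth ha 0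
  | succ k =>
    rw [iteratedDeriv_succ', hderiv]
    calc _ ≤ C * growth σ a k := hb k t
      _ ≤ C * growth σ a (k + 1) := by
        gcongr
        exact growth_le_growth (by linarith) ha le_rfl (Nat.le_succ k)
      _ ≤ _ := by
        gcongr
        exact le_max_right _ _

/-! ### The flat function `exp(-1/t)` -/

/-- Differentiating `x^{-i} exp(-1/x)` stays within the family indexed by `i`, which makes an
induction on the order possible. -/
theorem iteratedDeriv_succ_inv_pow_mul_expNegInvGlue (k i : ℕ) (t : ℝ) :
    iteratedDeriv (k + 1) (fun x => x⁻¹ ^ i * expNegInvGlue x) t =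
      iteratedDeriv k (fun x => x⁻¹ ^ (i + 2) * expNegInvGlue x) t -
        i * iteratedDeriv k (fun x => x⁻¹ ^ (i + 1) * expNegInvGlue x) t := by
  have hs : ∀ j : ℕ, ContDiff ℝ ∞ (fun x : ℝ => x⁻¹ ^ j * expNegInvGlue x) := fun j => by
    simpa using expNegInvGlue.contDiff_polynomial_eval_inv_mul (n := ⊤) (Polynomial.X ^ j)
  have hk : ((k : ℕ∞) : WithTop ℕ∞) ≤ (∞ : WithTop ℕ∞) := by exact_mod_cast le_top
  have hd : deriv (fun x : ℝ => x⁻¹ ^ i * expNegInvGlue x) =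
      (fun x => x⁻¹ ^ (i + 2) * expNegInvGlue x) -
        fun x => (i : ℝ) * (x⁻¹ ^ (i + 1) * expNegInvGlue x) := by
    funext x
    have h := (expNegInvGlue.hasDerivAt_polynomial_eval_inv_mul (Polynomial.X ^ i) x).deriv
    simp only [Polynomial.eval_pow, Polynomial.eval_X] at h
    rw [h]
    cases i with
    | zero => simp
    | succ i => simp; ring
  rw [iteratedDeriv_succ', hd, iteratedDeriv_sub ((hs _).of_le hk).contDiffAt
    ((contDiff_const.mul (hs _)).of_le hk).contDiffAt, iteratedDeriv_const_mul_field]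

/-- The base case is `y^i ≤ i! exp y` with `y = 1/t`. In the inductive step both terms of the
recursion are at most `2^k (i + 2k + 2)!`, hence one factor 2 per derivative. -/
theorem abs_iteratedDeriv_inv_pow_mul_expNegInvGlue_le (k i : ℕ) (t : ℝ) :
    |iteratedDeriv k (fun x => x⁻¹ ^ i * expNegInvGlue x) t| ≤ 2 ^ k * (i + 2 * k).factorial := by
  induction k generalizing i with
  | zero =>
    rcases le_or_gt t 0 with ht | ht
    · simp [expNegInvGlue.zero_of_nonpos ht]
    · have ht' : 0 < t⁻¹ := inv_pos.2 ht
      have h := Real.pow_div_factorial_le_exp t⁻¹ ht'.le i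
      rw [div_le_iff₀ (by positivity)] at h
      simp only [iteratedDeriv_zero, expNegInvGlue, ht.not_ge, if_false, Real.exp_neg]
      rw [abs_of_nonneg (by positivity), ← div_eq_mul_inv, div_le_iff₀ (Real.exp_pos _)]
      simpa [mul_comm] using h
  | succ k ih =>
    rw [iteratedDeriv_succ_inv_pow_mul_expNegInvGlue]
    have e1 : i + 2 * (k + 1) = (i + 2 * k + 1) + 1 := by ring
    have h1 := ih (i + 2)
    have h2 := ih (i + 1)
    rw [show i + 2 + 2 * k = (i + 2 * k + 1) + 1 by ring] at h1
    rw [show i + 1 + 2 * k = i + 2 * k + 1 by ring] at h2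
    rw [e1]
    have h3 : (i : ℝ) * (i + 2 * k + 1).factorial ≤ ((i + 2 * k + 1) + 1).factorial := by
      rw [Nat.factorial_succ (i + 2 * k + 1)]
      push_cast
      gcongr
      linarith [(k.cast_nonneg : (0 : ℝ) ≤ k)]
    calc _ ≤ 2 ^ k * ((i + 2 * k + 1 + 1).factorial : ℝ)
          + i * (2 ^ k * (i + 2 * k + 1).factorial) := by
          refine (abs_sub _ _).trans ?_
          rw [abs_mul, Nat.abs_cast]
          gcongr
      _ = 2 ^ k * ((i + 2 * k + 1 + 1).factorial + i * (i + 2 * k + 1).factorial) := by ring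
      _ ≤ 2 ^ k * ((i + 2 * k + 1 + 1).factorial + (i + 2 * k + 1 + 1).factorial) := by gcongr
      _ = _ := by ring

theorem lineClass_expNegInvGlue {σ : ℝ} (hσ : 1 ≤ σ) :
    LineClass σ (fun t => (expNegInvGlue t : ℂ)) := by
  have hc : ContDiff ℝ ∞ expNegInvGlue := expNegInvGlue.contDiff (n := ⊤)
  -- The exponent 5 comes from `2^k (2k)! ≤ (k+2)^k ((k+2)^2)^{2k}`.
  refine ⟨Complex.ofRealCLM.contDiff.comp hc, 5, 1, by norm_num, by norm_num, fun k t => ?_⟩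
  have h := Complex.ofRealLI.norm_iteratedFDeriv_comp_left (i := k) (hc.contDiffAt (x := t))
    (by exact_mod_cast le_top)
  have h' := abs_iteratedDeriv_inv_pow_mul_expNegInvGlue_le k 0 t
  rw [← norm_iteratedFDeriv_eq_norm_iteratedDeriv]
  change ‖iteratedFDeriv ℝ k (Complex.ofRealLI ∘ expNegInvGlue) t‖ ≤ _
  rw [h, norm_iteratedFDeriv_eq_norm_iteratedDeriv, Real.norm_eq_abs, one_mul]
  simp only [pow_zero, one_mul, zero_add] at h'
  refine h'.trans (le_trans ?_ (pow_mul_le_growth hσ 5 k))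
  have hf : ((2 * k).factorial : ℝ) ≤ (2 * k : ℝ) ^ (2 * k) := by
    exact_mod_cast Nat.factorial_le_pow (2 * k)
  have h0 : (0 : ℝ) ≤ k := k.cast_nonneg
  calc (2 : ℝ) ^ k * (2 * k).factorial
      ≤ ((k : ℝ) + 2) ^ k * (((k : ℝ) + 2) ^ 2) ^ (2 * k) := by
        refine mul_le_mul (pow_le_pow_left₀ (by norm_num) (by linarith) k)
          (hf.trans (pow_le_pow_left₀ (by positivity) (by nlinarith) _)) (by positivity)
          (by positivity)
    _ = _ := by
        rw [← pow_mul, ← pow_add]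
        congr 1
        ring

/-! ### Cut-off functions -/

theorem LineClass.comp_add_const {σ : ℝ} {φ : ℝ → ℂ} (hφ : LineClass σ φ) (r : ℝ) :
    LineClass σ (fun t => φ (t + r)) := by
  simpa using hφ.comp_sub_const (-r)

/-- The step is the primitive of the bump `exp(-1/t) exp(-1/(r-t))` on `(0, r)`. Its plateau value
is a positive integral, which need not be normalized. -/
theorem exists_lineClass_step {σ : ℝ} (hσ : 1 ≤ σ) {r : ℝ} (hr : 0 < r) :
    ∃ s : ℝ → ℂ, LineClass σ s ∧ (∀ t ≤ 0, s t = 0) ∧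
      ∃ S : ℂ, S ≠ 0 ∧ ∀ t, r ≤ t → s t = S := by
  set b : ℝ → ℝ := fun t => expNegInvGlue t * expNegInvGlue (r - t) with hb
  have he : Continuous expNegInvGlue := (expNegInvGlue.contDiff (n := 0)).continuous
  have hbc : Continuous b := he.mul (he.comp (continuous_const.sub continuous_id))
  have hbcl : LineClass σ (fun t => (b t : ℂ)) := by
    simpa [hb] using (lineClass_expNegInvGlue hσ).mul hσ
      ((lineClass_expNegInvGlue hσ).comp_const_sub r)
  set s : ℝ → ℝ := fun t => ∫ x in (0 : ℝ)..t, b x with hs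
  have hsd : ∀ t, HasDerivAt s (b t) t := fun t => hbc.integral_hasStrictDerivAt 0 t |>.hasDerivAt
  have hint : ∀ u v, IntervalIntegrable b MeasureTheory.volume u v :=
    fun u v => hbc.intervalIntegrable u v
  have hs0 : ∀ t ≤ 0, s t = 0 := fun t ht => by
    refine (intervalIntegral.integral_congr (g := fun _ => 0) fun x hx => ?_).trans (by simp)
    rw [Set.uIcc_of_ge ht] at hx
    simp [hb, expNegInvGlue.zero_of_nonpos hx.2]
  have hsr : ∀ t, r ≤ t → s t = s r := fun t ht => by
    have h := intervalIntegral.integral_add_adjacent_intervals (hint 0 r) (hint r t)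
    have h0 : ∫ x in r..t, b x = 0 := by
      refine (intervalIntegral.integral_congr (g := fun _ => 0) fun x hx => ?_).trans (by simp)
      rw [Set.uIcc_of_le ht] at hx
      simp [hb, expNegInvGlue.zero_of_nonpos (sub_nonpos.2 hx.1)]
    rw [h0, add_zero] at h
    exact h.symm
  have hpos : 0 < s r := by
    refine intervalIntegral.intervalIntegral_pos_of_pos_on (hint 0 r) (fun x hx => ?_) hr
    exact mul_pos (expNegInvGlue.pos_of_pos hx.1) (expNegInvGlue.pos_of_pos (sub_pos.2 hx.2))
  have hsc : Continuous s := continuous_iff_continuousAt.2 fun t => (hsd t).continuousAt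
  obtain ⟨B, hB⟩ := (isCompact_Icc (a := (0 : ℝ)) (b := r)).exists_bound_of_continuousOn
    hsc.continuousOn
  have hB' : ∀ t, ‖((s t : ℝ) : ℂ)‖ ≤ B := fun t => by
    rw [Complex.norm_real]
    rcases le_total t 0 with h | h
    · rw [hs0 t h, ← hs0 0 le_rfl]
      exact hB 0 ⟨le_rfl, hr.le⟩
    · rcases le_total t r with h' | h'
      · exact hB t ⟨h, h'⟩
      · rw [hsr t h']
        exact hB r ⟨hr.le, le_rfl⟩
  refine ⟨fun t => (s t : ℂ), hbcl.of_hasDerivAt hσ (fun t => (hsd t).ofReal_comp) hB',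
    fun t ht => by simp [hs0 t ht], (s r : ℂ), by exact_mod_cast hpos.ne', fun t ht => by
      simp [hsr t ht]⟩

theorem exists_lineClass_cutoff {σ : ℝ} (hσ : 1 ≤ σ) {r : ℝ} (hr : 0 < r) :
    ∃ χ : ℝ → ℂ, LineClass σ χ ∧ (∀ t, r ≤ |t| → χ t = 0) ∧
      ∃ c : ℂ, c ≠ 0 ∧ χ =ᶠ[nhds 0] fun _ => c := by
  obtain ⟨s, hs, hs0, S, hS, hsS⟩ := exists_lineClass_step hσ (half_pos hr)
  refine ⟨fun t => s (t + r) * s (r - t), (hs.comp_add_const r).mul hσ (hs.comp_const_sub r),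
    fun t ht => ?_, S * S, mul_ne_zero hS hS, ?_⟩
  · rcases le_abs.1 ht with h | h
    · simp [hs0 (r - t) (by linarith)]
    · simp [hs0 (t + r) (by linarith)]
  · filter_upwards [Ioo_mem_nhds (neg_lt_zero.2 (half_pos hr)) (half_pos hr)] with t ht
    rw [hsS _ (by linarith [ht.1]), hsS _ (by linarith [ht.2])]

/-! ### Lacunary exponential series -/

/-- The frequencies `n^{2A n^{σ-1}}`. -/
def frequency (σ A : ℝ) (n : ℕ) : ℝ := (n : ℝ) ^ (2 * A * (n : ℝ) ^ (σ - 1))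

/-- The amplitudes `n^{-A n^σ}`. -/
def amplitude (σ A : ℝ) (n : ℕ) : ℝ := (n : ℝ) ^ (-(A * (n : ℝ) ^ σ))

theorem frequency_nonneg (σ A : ℝ) (n : ℕ) : 0 ≤ frequency σ A n :=
  Real.rpow_nonneg n.cast_nonneg _

theorem amplitude_nonneg (σ A : ℝ) (n : ℕ) : 0 ≤ amplitude σ A n :=
  Real.rpow_nonneg n.cast_nonneg _

/-- The factor `2k - n` explains the choice of frequencies and amplitudes: terms with `n ≥ 2k`
contribute at most 1, and the term `n = k` is exactly `k^{A k^σ}`. -/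
theorem amplitude_mul_frequency_pow (σ A : ℝ) {n : ℕ} (hn : 0 < n) (k : ℕ) :
    amplitude σ A n * frequency σ A n ^ k =
      (n : ℝ) ^ (A * (n : ℝ) ^ (σ - 1) * (2 * k - n)) := by
  have h : (0 : ℝ) < n := by exact_mod_cast hn
  unfold amplitude frequency
  rw [← Real.rpow_natCast, ← Real.rpow_mul h.le, ← Real.rpow_add h]
  congr 1
  have : (n : ℝ) ^ σ = (n : ℝ) ^ (σ - 1) * n := by
    rw [← Real.rpow_add_one h.ne']
    simp
  rw [this]
  ring

theorem amplitude_mul_frequency_pow_le {σ A : ℝ} (hσ : 1 ≤ σ) (hA : 0 ≤ A) (n k : ℕ) :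
    amplitude σ A n * frequency σ A n ^ k ≤ growth σ (2 * (A * 2 ^ σ)) k := by
  have h1 : 1 ≤ growth σ (2 * (A * 2 ^ σ)) k := one_le_growth (by positivity) k
  have hk0 : (0 : ℝ) ≤ k := k.cast_nonneg
  rcases Nat.eq_zero_or_pos n with rfl | hn
  -- The frequency at `n = 0` depends on whether `σ = 1`, so only the bound by 1 is used.
  · refine le_trans ?_ h1
    have h0 : amplitude σ A 0 = 1 := by
      simp [amplitude, Real.zero_rpow (by linarith : σ ≠ 0)]
    rw [h0, one_mul]
    refine pow_le_one₀ (frequency_nonneg _ _ _) ?_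
    exact Real.rpow_le_one (by simp) (by simp) (by positivity)
  · have hn1 : (1 : ℝ) ≤ n := by exact_mod_cast hn
    rw [amplitude_mul_frequency_pow σ A hn]
    rcases le_total (2 * k : ℝ) n with h | h
    · refine le_trans (Real.rpow_le_one_of_one_le_of_nonpos hn1 ?_) h1
      exact mul_nonpos_of_nonneg_of_nonpos (by positivity) (by linarith)
    · have hk : (0 : ℝ) < 2 * k := by linarith
      have he : A * (n : ℝ) ^ (σ - 1) * (2 * k - n) ≤ A * 2 ^ σ * (k : ℝ) ^ σ := by
        calc A * (n : ℝ) ^ (σ - 1) * (2 * k - n) ≤ A * (2 * k : ℝ) ^ (σ - 1) * (2 * k) := by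
              gcongr
              linarith
          _ = A * (2 * k : ℝ) ^ σ := by
              rw [mul_assoc, ← Real.rpow_add_one hk.ne']
              simp
          _ = _ := by
              rw [Real.mul_rpow (by norm_num) hk0]
              ring
      calc (n : ℝ) ^ (A * (n : ℝ) ^ (σ - 1) * (2 * k - n))
          ≤ (n : ℝ) ^ (A * 2 ^ σ * (k : ℝ) ^ σ) := Real.rpow_le_rpow_of_exponent_le hn1 he
        -- Here `n ≤ 2k ≤ (k+2)^2`, which accounts for the leading 2 in the growth parameter.
        _ ≤ (((k : ℝ) + 2) ^ (2 : ℝ)) ^ (A * 2 ^ σ * (k : ℝ) ^ σ) := by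
            refine Real.rpow_le_rpow (by positivity) ?_ (by positivity)
            rw [Real.rpow_two]
            nlinarith
        _ = _ := by
            rw [← Real.rpow_mul (by positivity)]
            unfold growth
            congr 1
            ring

theorem amplitude_mul_frequency_pow_self {σ A : ℝ} (hσ : 1 ≤ σ) (k : ℕ) :
    amplitude σ A k * frequency σ A k ^ k = pttSeq A σ k := by
  rcases Nat.eq_zero_or_pos k with rfl | hk
  · simp [amplitude, pttSeq, Real.zero_rpow (by linarith : σ ≠ 0)]
  · have h : (0 : ℝ) < k := by exact_mod_cast hk
    rw [amplitude_mul_frequency_pow σ A hk, pttSeq]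
    congr 1
    have : (k : ℝ) ^ σ = (k : ℝ) ^ (σ - 1) * k := by
      rw [← Real.rpow_add_one h.ne']
      simp
    rw [this]
    ring

theorem contDiff_cexp_mul_I (b : ℝ) : ContDiff ℝ ∞ fun t : ℝ => Complex.exp (b * t * Complex.I) :=
  Complex.contDiff_exp.comp
    ((contDiff_const.mul Complex.ofRealCLM.contDiff).mul contDiff_const)

theorem iteratedDeriv_cexp_mul_I (a b : ℝ) (k : ℕ) (t : ℝ) :
    iteratedDeriv k (fun t : ℝ => (a : ℂ) * Complex.exp (b * t * Complex.I)) t =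
      a * (b * Complex.I) ^ k * Complex.exp (b * t * Complex.I) := by
  induction k generalizing t with
  | zero => simp
  | succ k ih =>
    rw [iteratedDeriv_succ, funext ih]
    have h : HasDerivAt (fun t : ℝ => (b : ℂ) * t * Complex.I) (b * 1 * Complex.I) t :=
      ((Complex.ofRealCLM.hasDerivAt (x := t)).const_mul (b : ℂ)).mul_const Complex.I
    rw [(h.cexp.const_mul _).deriv]
    ring

theorem norm_iteratedDeriv_cexp_mul_I {a b : ℝ} (ha : 0 ≤ a) (hb : 0 ≤ b) (k : ℕ) (t : ℝ) :
    ‖iteratedDeriv k (fun t : ℝ => (a : ℂ) * Complex.exp (b * t * Complex.I)) t‖ = a * b ^ k := by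
  rw [iteratedDeriv_cexp_mul_I, ← Complex.ofReal_mul, norm_mul, Complex.norm_exp_ofReal_mul_I]
  simp [abs_of_nonneg ha, abs_of_nonneg hb]

/-- The lacunary series `∑ 2^{-n} n^{-A n^σ} exp(i n^{2A n^{σ-1}} t)`. -/
def lacunarySeries (σ A : ℝ) (t : ℝ) : ℂ :=
  ∑' n : ℕ, (((1 / 2) ^ n * amplitude σ A n : ℝ) : ℂ) *
    Complex.exp ((frequency σ A n : ℂ) * t * Complex.I)

theorem contDiff_lacunary_term (a b : ℝ) :
    ContDiff ℝ ∞ fun t : ℝ => (a : ℂ) * Complex.exp (b * t * Complex.I) :=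
  contDiff_const.mul (contDiff_cexp_mul_I b)

theorem norm_iteratedFDeriv_lacunary_term_le {σ A : ℝ} (hσ : 1 ≤ σ) (hA : 0 ≤ A) (k n : ℕ)
    (t : ℝ) :
    ‖iteratedFDeriv ℝ k (fun t : ℝ => (((1 / 2) ^ n * amplitude σ A n : ℝ) : ℂ) *
      Complex.exp ((frequency σ A n : ℂ) * t * Complex.I)) t‖ ≤
      (1 / 2) ^ n * growth σ (2 * (A * 2 ^ σ)) k := by
  rw [norm_iteratedFDeriv_eq_norm_iteratedDeriv, norm_iteratedDeriv_cexp_mul_I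
    (mul_nonneg (by positivity) (amplitude_nonneg σ A n)) (frequency_nonneg σ A n), mul_assoc]
  gcongr
  exact amplitude_mul_frequency_pow_le hσ hA n k

theorem summable_lacunary_bound (G : ℝ) : Summable fun n : ℕ => (1 / 2 : ℝ) ^ n * G :=
  summable_geometric_two.mul_right G

theorem contDiff_lacunarySeries {σ A : ℝ} (hσ : 1 ≤ σ) (hA : 0 ≤ A) :
    ContDiff ℝ ∞ (lacunarySeries σ A) :=
  contDiff_tsum (N := ⊤) (fun _ => contDiff_lacunary_term _ _)
    (fun k _ => summable_lacunary_bound (growth σ (2 * (A * 2 ^ σ)) k))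
    (fun k n t _ => norm_iteratedFDeriv_lacunary_term_le hσ hA k n t)

theorem iteratedFDeriv_lacunarySeries {σ A : ℝ} (hσ : 1 ≤ σ) (hA : 0 ≤ A) (k : ℕ) (t : ℝ) :
    iteratedFDeriv ℝ k (lacunarySeries σ A) t =
      ∑' n : ℕ, iteratedFDeriv ℝ k (fun t : ℝ => (((1 / 2) ^ n * amplitude σ A n : ℝ) : ℂ) *
        Complex.exp ((frequency σ A n : ℂ) * t * Complex.I)) t :=
  iteratedFDeriv_tsum_apply (N := ⊤) (fun _ => contDiff_lacunary_term _ _)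
    (fun k _ => summable_lacunary_bound (growth σ (2 * (A * 2 ^ σ)) k))
    (fun k n t _ => norm_iteratedFDeriv_lacunary_term_le hσ hA k n t) le_top t

theorem lineClass_lacunarySeries {σ A : ℝ} (hσ : 1 ≤ σ) (hA : 0 ≤ A) :
    LineClass σ (lacunarySeries σ A) := by
  refine ⟨contDiff_lacunarySeries hσ hA, 2 * (A * 2 ^ σ), 2, by positivity, by norm_num,
    fun k t => ?_⟩
  rw [← norm_iteratedFDeriv_eq_norm_iteratedDeriv, iteratedFDeriv_lacunarySeries hσ hA]
  exact tsum_of_norm_bounded (hasSum_geometric_two.mul_right _)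
    fun n => norm_iteratedFDeriv_lacunary_term_le hσ hA k n t

/-- At the origin every term of the differentiated series is a nonnegative multiple of the same unit
`I^k`, so the single term `n = k` bounds the norm from below. -/
theorem le_norm_iteratedDeriv_lacunarySeries {σ A : ℝ} (hσ : 1 ≤ σ) (hA : 0 ≤ A) (k : ℕ) :
    (1 / 2) ^ k * pttSeq A σ k ≤ ‖iteratedDeriv k (lacunarySeries σ A) 0‖ := by
  set u : ℕ → ℝ := fun n => (1 / 2) ^ n * amplitude σ A n * frequency σ A n ^ k with hu
  have hu0 : ∀ n, 0 ≤ u n := fun n => mul_nonneg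
    (mul_nonneg (by positivity) (amplitude_nonneg σ A n)) (pow_nonneg (frequency_nonneg σ A n) k)
  have hus : Summable u := by
    refine Summable.of_nonneg_of_le hu0 (fun n => ?_)
      (summable_lacunary_bound (growth σ (2 * (A * 2 ^ σ)) k))
    simp only [hu, mul_assoc]
    gcongr
    exact amplitude_mul_frequency_pow_le hσ hA n k
  have hsum : Summable fun n : ℕ => iteratedFDeriv ℝ k
      (fun t : ℝ => (((1 / 2) ^ n * amplitude σ A n : ℝ) : ℂ) *
        Complex.exp ((frequency σ A n : ℂ) * t * Complex.I)) 0 :=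
    Summable.of_norm_bounded (summable_lacunary_bound (growth σ (2 * (A * 2 ^ σ)) k))
      fun n => norm_iteratedFDeriv_lacunary_term_le hσ hA k n 0
  have key : iteratedDeriv k (lacunarySeries σ A) 0 = ((∑' n, u n : ℝ) : ℂ) * Complex.I ^ k := by
    rw [iteratedDeriv_eq_iteratedFDeriv, iteratedFDeriv_lacunarySeries hσ hA,
      ContinuousMultilinearMap.tsum_eval hsum, Complex.ofReal_tsum, ← tsum_mul_right]
    refine tsum_congr fun n => ?_
    rw [← iteratedDeriv_eq_iteratedFDeriv, iteratedDeriv_cexp_mul_I, hu]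
    push_cast
    simp
    ring
  rw [key, norm_mul, norm_pow, Complex.norm_I, one_pow, mul_one, Complex.norm_real,
    Real.norm_of_nonneg (tsum_nonneg hu0)]
  calc (1 / 2) ^ k * pttSeq A σ k = u k := by
        simp only [hu, ← amplitude_mul_frequency_pow_self hσ, mul_assoc]
    _ ≤ ∑' n, u n := hus.le_tsum k fun n _ => hu0 n

/-- Compactly supported functions whose derivatives at the origin grow at least like
`2^{-k} k^{A k^σ}`. -/
theorem exists_lineClass_bump {σ A : ℝ} (hσ : 1 ≤ σ) (hA : 0 ≤ A) {r : ℝ} (hr : 0 < r) :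
    ∃ φ : ℝ → ℂ, LineClass σ φ ∧ (∀ t, r ≤ |t| → φ t = 0) ∧
      ∃ c : ℝ, 0 < c ∧ ∀ k, c * ((1 / 2) ^ k * pttSeq A σ k) ≤ ‖iteratedDeriv k φ 0‖ := by
  obtain ⟨χ, hχ, hχ0, c, hc, hχc⟩ := exists_lineClass_cutoff hσ hr
  refine ⟨fun t => χ t * lacunarySeries σ A t, hχ.mul hσ (lineClass_lacunarySeries hσ hA),
    fun t ht => by simp [hχ0 t ht], ‖c‖, norm_pos_iff.2 hc, fun k => ?_⟩
  have h : (fun t => χ t * lacunarySeries σ A t) =ᶠ[nhds 0] fun t => c * lacunarySeries σ A t := by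
    filter_upwards [hχc] with t ht
    rw [ht]
  have hk : ((k : ℕ∞) : WithTop ℕ∞) ≤ (∞ : WithTop ℕ∞) := by exact_mod_cast le_top
  rw [h.iteratedDeriv_eq k, iteratedDeriv_const_mul c
    ((contDiff_lacunarySeries hσ hA).of_le hk).contDiffAt, norm_mul]
  gcongr
  exact le_norm_iteratedDeriv_lacunarySeries hσ hA k

/-! ### Partial derivatives -/

theorem _root_.Filter.EventuallyEq.partialDeriv {d : ℕ} {f g : Space d → ℂ} {x : Space d}
    (h : f =ᶠ[nhds x] g) (i : Fin d) : partialDeriv i f =ᶠ[nhds x] partialDeriv i g := by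
  filter_upwards [h.fderiv (𝕜 := ℝ)] with y hy
  simp only [PTT.partialDeriv, hy]

theorem _root_.Filter.EventuallyEq.partialDeriv_iterate {d : ℕ} {f g : Space d → ℂ} {x : Space d}
    (h : f =ᶠ[nhds x] g) (i : Fin d) (n : ℕ) :
    (PTT.partialDeriv i)^[n] f =ᶠ[nhds x] (PTT.partialDeriv i)^[n] g := by
  induction n with
  | zero => exact h
  | succ n ih => simpa only [Function.iterate_succ_apply'] using ih.partialDeriv i

theorem _root_.Filter.EventuallyEq.multiDeriv {d : ℕ} {f g : Space d → ℂ} {x : Space d}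
    (h : f =ᶠ[nhds x] g) (α : Fin d → ℕ) : multiDeriv α f =ᶠ[nhds x] multiDeriv α g := by
  unfold PTT.multiDeriv
  induction List.finRange d with
  | nil => exact h
  | cons i l ih => exact ih.partialDeriv_iterate i (α i)

theorem contDiff_partialDeriv {d : ℕ} {f : Space d → ℂ} (hf : ContDiff ℝ ∞ f) (i : Fin d) :
    ContDiff ℝ ∞ (partialDeriv i f) :=
  (hf.fderiv_right (m := ∞) (by simp)).clm_apply contDiff_const

theorem contDiff_partialDeriv_iterate {d : ℕ} {f : Space d → ℂ} (hf : ContDiff ℝ ∞ f)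
    (i : Fin d) (n : ℕ) : ContDiff ℝ ∞ ((partialDeriv i)^[n] f) := by
  induction n with
  | zero => exact hf
  | succ n ih => simpa only [Function.iterate_succ_apply'] using contDiff_partialDeriv ih i

theorem partialDeriv_iterate_add {d : ℕ} {f g : Space d → ℂ} (hf : ContDiff ℝ ∞ f)
    (hg : ContDiff ℝ ∞ g) (i : Fin d) (n : ℕ) :
    (partialDeriv i)^[n] (f + g) = (partialDeriv i)^[n] f + (partialDeriv i)^[n] g := by
  induction n with
  | zero => rfl
  | succ n ih =>
    simp only [Function.iterate_succ_apply', ih]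
    funext x
    simp only [partialDeriv, Pi.add_apply]
    rw [fderiv_add ((contDiff_partialDeriv_iterate hf i n).differentiable (by simp) x)
      ((contDiff_partialDeriv_iterate hg i n).differentiable (by simp) x)]
    rfl

theorem multiDeriv_add {d : ℕ} {f g : Space d → ℂ} (hf : ContDiff ℝ ∞ f) (hg : ContDiff ℝ ∞ g)
    (α : Fin d → ℕ) : multiDeriv α (f + g) = multiDeriv α f + multiDeriv α g := by
  have hc : ∀ {f : Space d → ℂ} (_ : ContDiff ℝ ∞ f) (l : List (Fin d)),
      ContDiff ℝ ∞ (l.foldr (fun i g => (partialDeriv i)^[α i] g) f) := fun hf l => by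
    induction l with
    | nil => exact hf
    | cons i l ih => exact contDiff_partialDeriv_iterate ih i (α i)
  unfold multiDeriv
  induction List.finRange d with
  | nil => rfl
  | cons i l ih =>
    rw [List.foldr_cons, ih]
    exact partialDeriv_iterate_add (hc hf l) (hc hg l) i (α i)

/-! ### Tensor products of functions of one variable -/

/-- The tensor product `x ↦ ∏ i, u i (x i)`. -/
def tensor {d : ℕ} (u : Fin d → ℝ → ℂ) (x : Space d) : ℂ := ∏ i, u i (x i)

theorem contDiff_tensor {d : ℕ} {u : Fin d → ℝ → ℂ} (hu : ∀ i, ContDiff ℝ ∞ (u i)) :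
    ContDiff ℝ ∞ (tensor u) :=
  contDiff_prod fun i _ => (hu i).comp (EuclideanSpace.proj (𝕜 := ℝ) i).contDiff

theorem partialDeriv_tensor {d : ℕ} {u : Fin d → ℝ → ℂ} (hu : ∀ i, ContDiff ℝ ∞ (u i))
    (i : Fin d) : partialDeriv i (tensor u) = tensor (Function.update u i (deriv (u i))) := by
  funext x
  have h1 : ∀ j ∈ Finset.univ, HasFDerivAt (fun x : Space d => u j (x j))
      ((EuclideanSpace.proj (𝕜 := ℝ) j).smulRight (deriv (u j) (x j))) x := fun j _ => by
    have hp : HasFDerivAt (fun x : Space d => x j) (EuclideanSpace.proj (𝕜 := ℝ) j) x :=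
      (EuclideanSpace.proj (𝕜 := ℝ) j).hasFDerivAt
    have hj := ((hu j).differentiable (by simp) (x j)).hasDerivAt.hasFDerivAt
    exact (HasFDerivAt.comp (g := u j) x hj hp).congr_fderiv (by ext v; simp)
  have h2 := HasFDerivAt.finsetProd h1
  simp only [partialDeriv]
  unfold tensor
  rw [h2.fderiv]
  simp only [_root_.sum_apply, _root_.smul_apply, ContinuousLinearMap.smulRight_apply,
    PiLp.proj_apply]
  rw [Finset.sum_eq_single i]
  · rw [← Finset.mul_prod_erase _ _ (Finset.mem_univ i)]
    simp only [Function.update_self, smul_eq_mul]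
    rw [mul_comm]
    congr 1
    · simp
    · refine Finset.prod_congr rfl fun j hj => ?_
      rw [Function.update_of_ne (Finset.ne_of_mem_erase hj)]
  · intro j _ hj
    simp [hj]
  · simp

theorem contDiff_iteratedDeriv_of_smooth {φ : ℝ → ℂ} (hφ : ContDiff ℝ ∞ φ) (n : ℕ) :
    ContDiff ℝ ∞ (iteratedDeriv n φ) := by
  induction n with
  | zero => simpa using hφ
  | succ n ih =>
    rw [iteratedDeriv_succ]
    exact (contDiff_infty_iff_deriv.1 ih).2

theorem contDiff_update_iteratedDeriv {d : ℕ} {u : Fin d → ℝ → ℂ}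
    (hu : ∀ i, ContDiff ℝ ∞ (u i)) (i : Fin d) (n : ℕ) (j : Fin d) :
    ContDiff ℝ ∞ (Function.update u i (iteratedDeriv n (u i)) j) := by
  rcases eq_or_ne j i with rfl | h
  · simpa using contDiff_iteratedDeriv_of_smooth (hu j) n
  · simpa [h] using hu j

theorem partialDeriv_iterate_tensor {d : ℕ} {u : Fin d → ℝ → ℂ} (hu : ∀ i, ContDiff ℝ ∞ (u i))
    (i : Fin d) (n : ℕ) :
    (partialDeriv i)^[n] (tensor u) = tensor (Function.update u i (iteratedDeriv n (u i))) := by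
  induction n with
  | zero => simp
  | succ n ih =>
    rw [Function.iterate_succ_apply', ih,
      partialDeriv_tensor (contDiff_update_iteratedDeriv hu i n)]
    simp [iteratedDeriv_succ]

theorem multiDeriv_tensor {d : ℕ} {u : Fin d → ℝ → ℂ} (hu : ∀ i, ContDiff ℝ ∞ (u i))
    (α : Fin d → ℕ) :
    multiDeriv α (tensor u) = tensor fun i => iteratedDeriv (α i) (u i) := by
  -- Without repetitions in `l`, each factor is still undifferentiated when its turn comes.
  have key : ∀ l : List (Fin d), l.Nodup →
      l.foldr (fun i g => (partialDeriv i)^[α i] g) (tensor u) =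
        tensor fun i => if i ∈ l then iteratedDeriv (α i) (u i) else u i := by
    intro l hl
    induction l with
    | nil => simp
    | cons i l ih =>
      obtain ⟨hi, hl⟩ := List.nodup_cons.1 hl
      rw [List.foldr_cons, ih hl, partialDeriv_iterate_tensor]
      · congr 1
        funext j
        rcases eq_or_ne j i with rfl | h
        · simp [hi]
        · simp [h]
      · intro j
        split_ifs
        · exact contDiff_iteratedDeriv_of_smooth (hu j) _
        · exact hu j
  unfold multiDeriv
  rw [key _ (List.nodup_finRange d)]
  simp

/-! ### Smooth functions of several variables with derivatives of controlled growth -/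

/-- Smooth functions on `ℝ^d` with partial derivatives uniformly `O((|α| + 2)^{a |α|^σ})` for
some `a`. -/
structure SpaceClass {d : ℕ} (σ : ℝ) (f : Space d → ℂ) : Prop where
  contDiff : ContDiff ℝ ∞ f
  bound : ∃ a C : ℝ, 0 ≤ a ∧ 0 ≤ C ∧ ∀ α x, ‖multiDeriv α f x‖ ≤ C * growth σ a (multiLength α)

theorem prod_growth_le {σ a : ℝ} (hσ : 1 ≤ σ) (ha : 0 ≤ a) {ι : Type*} (s : Finset ι)
    (α : ι → ℕ) : ∏ i ∈ s, growth σ a (α i) ≤ growth σ a (∑ i ∈ s, α i) := by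
  classical
  induction s using Finset.induction_on with
  | empty => simpa using one_le_growth ha 0
  | insert i s hi ih =>
    rw [Finset.prod_insert hi, Finset.sum_insert hi]
    refine le_trans ?_ (growth_mul_le hσ ha le_rfl _ _)
    have := growth_pos σ a (α i)
    gcongr

theorem LineClass.spaceClass_tensor {d : ℕ} {σ : ℝ} (hσ : 1 ≤ σ) {φ : ℝ → ℂ}
    (hφ : LineClass σ φ) (c : Space d) : SpaceClass σ (tensor fun i t => φ (t - c i)) := by
  obtain ⟨a, C, ha, hC, hb⟩ := hφ.bound
  have hs : ∀ i, ContDiff ℝ ∞ (fun t => φ (t - c i)) := fun i => (hφ.comp_sub_const _).contDiff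
  refine ⟨contDiff_tensor hs, a, C ^ d, ha, by positivity, fun α x => ?_⟩
  rw [multiDeriv_tensor hs, tensor, norm_prod]
  calc ∏ i, ‖iteratedDeriv (α i) (fun t => φ (t - c i)) (x i)‖
      ≤ ∏ i, C * growth σ a (α i) := by
        refine Finset.prod_le_prod (fun _ _ => norm_nonneg _) fun i _ => ?_
        rw [iteratedDeriv_comp_sub_const]
        exact hb _ _
    _ = C ^ d * ∏ i, growth σ a (α i) := by simp [Finset.prod_mul_distrib]
    _ ≤ _ := by
        gcongr
        exact prod_growth_le hσ ha _ _

theorem SpaceClass.add {d : ℕ} {σ : ℝ} (hσ : 0 ≤ σ) {f g : Space d → ℂ} (hf : SpaceClass σ f)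
    (hg : SpaceClass σ g) : SpaceClass σ (f + g) := by
  obtain ⟨a, C, ha, hC, hfb⟩ := hf.bound
  obtain ⟨b, D, hb, hD, hgb⟩ := hg.bound
  refine ⟨hf.contDiff.add hg.contDiff, max a b, C + D, by positivity, by positivity,
    fun α x => ?_⟩
  rw [multiDeriv_add hf.contDiff hg.contDiff, add_mul]
  refine (norm_add_le _ _).trans (add_le_add ((hfb α x).trans ?_) ((hgb α x).trans ?_))
  · gcongr
    exact growth_le_growth hσ ha (le_max_left _ _) le_rfl
  · gcongr
    exact growth_le_growth hσ hb (le_max_right _ _) le_rfl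

theorem spaceClass_zero {d : ℕ} (σ : ℝ) : SpaceClass σ (0 : Space d → ℂ) := by
  refine ⟨contDiff_const, 0, 0, le_rfl, le_rfl, fun α x => ?_⟩
  -- By additivity the derivative `g` of zero satisfies `g = g + g`.
  have h : (0 : Space d → ℂ) = 0 + 0 := by simp
  have h' := congrFun (multiDeriv_add (contDiff_const (c := (0 : ℂ)))
    (contDiff_const (c := (0 : ℂ))) α) x
  have h0 : multiDeriv α (0 : Space d → ℂ) x = multiDeriv α 0 x + multiDeriv α 0 x := by
    conv_lhs => rw [h]
    exact h'
  simp [left_eq_add.1 h0]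

theorem SpaceClass.sum {d : ℕ} {σ : ℝ} (hσ : 0 ≤ σ) {ι : Type*} (s : Finset ι)
    {f : ι → Space d → ℂ} (hf : ∀ i, SpaceClass σ (f i)) : SpaceClass σ (∑ i ∈ s, f i) := by
  classical
  induction s using Finset.induction_on with
  | empty => exact spaceClass_zero σ
  | insert i s hi ih =>
    rw [Finset.sum_insert hi]
    exact (hf i).add hσ ih

/-! ### Seminorms -/

theorem weightSeminorm_lt_top_iff {d : ℕ} {M Φ : ℕ → ℝ} (hM : ∀ j, 0 < M j) {h : ℝ} (hh : 0 < h)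
    (K : Set (Space d)) (f : Space d → ℂ) :
    weightSeminorm M Φ K h f < ⊤ ↔ ∃ C : ℝ, 0 ≤ C ∧ ∀ α, ∀ x ∈ K,
      ‖multiDeriv α f x‖ ≤ C * (h ^ Φ (multiLength α) * M (multiLength α)) := by
  have hp : ∀ j, 0 < h ^ Φ j * M j := fun j => mul_pos (Real.rpow_pos_of_pos hh _) (hM j)
  constructor
  · intro hlt
    refine ⟨_, ENNReal.toReal_nonneg (a := weightSeminorm M Φ K h f), fun α x hx => ?_⟩
    rw [← div_le_iff₀ (hp _), ← ENNReal.ofReal_le_iff_le_toReal hlt.ne]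
    exact le_iSup_of_le α (le_iSup₂_of_le x hx le_rfl)
  · rintro ⟨C, -, hC⟩
    refine lt_of_le_of_lt (iSup_le fun α => iSup₂_le fun x hx => ?_)
      (ENNReal.ofReal_lt_top (r := C))
    exact ENNReal.ofReal_le_ofReal ((div_le_iff₀ (hp _)).2 (hC α x hx))

theorem weightSeminorm_congr {d : ℕ} (M Φ : ℕ → ℝ) {K : Set (Space d)} (h : ℝ)
    {f g : Space d → ℂ} (hfg : ∀ x ∈ K, f =ᶠ[nhds x] g) :
    weightSeminorm M Φ K h f = weightSeminorm M Φ K h g := by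
  unfold weightSeminorm
  refine iSup_congr fun α => iSup_congr fun x => iSup_congr fun hx => ?_
  rw [((hfg x hx).multiDeriv α).eq_of_nhds]

theorem pttSeq_pos {σ : ℝ} (hσ : σ ≠ 0) (τ : ℝ) (j : ℕ) : 0 < pttSeq τ σ j := by
  rcases Nat.eq_zero_or_pos j with rfl | hj
  · simp [pttSeq, Real.zero_rpow hσ]
  · exact Real.rpow_pos_of_pos (by exact_mod_cast hj) _

/-- For `k ≥ 1` one has `k + 2 ≤ 3k`; the power of 3 is absorbed by the factor `h^{k^σ}` of the
seminorm. -/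
theorem growth_le_pttSeq {σ τ : ℝ} (hσ : σ ≠ 0) (hτ : 0 ≤ τ) (k : ℕ) :
    growth σ τ k ≤ ((3 : ℝ) ^ τ) ^ ((k : ℝ) ^ σ) * pttSeq τ σ k := by
  rcases Nat.eq_zero_or_pos k with rfl | hk
  · simp [growth, pttSeq, Real.zero_rpow hσ]
  · have hk1 : (1 : ℝ) ≤ k := by exact_mod_cast hk
    rw [← Real.rpow_mul (by norm_num), pttSeq, ← Real.mul_rpow (by norm_num) (by linarith)]
    exact Real.rpow_le_rpow (by linarith) (by linarith) (by positivity)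

theorem SpaceClass.mem_pttLimitClass {d : ℕ} {σ : ℝ} (hσ : 1 ≤ σ) {f : Space d → ℂ}
    (hf : SpaceClass σ f) (U : Set (Space d)) : f ∈ pttLimitClass σ U := by
  obtain ⟨a, C, ha, hC, hb⟩ := hf.bound
  have hσ0 : σ ≠ 0 := by linarith
  -- The parameter `τ` must be positive, while `a` may vanish.
  refine ⟨a + 1, by linarith, hf.contDiff.contDiffOn, fun K _ _ =>
    ⟨3 ^ (a + 1), Real.rpow_pos_of_pos (by norm_num) _, ?_⟩⟩
  rw [weightSeminorm_lt_top_iff (pttSeq_pos hσ0 _) (Real.rpow_pos_of_pos (by norm_num) _)]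
  refine ⟨C, hC, fun α x _ => (hb α x).trans ?_⟩
  gcongr
  exact (growth_le_growth (by linarith) ha (by linarith) le_rfl).trans
    (growth_le_pttSeq hσ0 (by linarith) _)

/-! ### Bump functions outside the classes with small parameter -/

theorem exists_spaceClass_bump {d : ℕ} (hd : 1 ≤ d) {σ A : ℝ} (hσ : 1 ≤ σ) (hA : 0 ≤ A)
    (c : Space d) {r : ℝ} (hr : 0 < r) :
    ∃ f : Space d → ℂ, SpaceClass σ f ∧ (∀ x ∉ Metric.closedBall c r, f x = 0) ∧
      ∃ b : ℝ, 0 < b ∧ ∀ k, ∃ α : Fin d → ℕ, multiLength α = k ∧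
        b * ((1 / 2) ^ k * pttSeq A σ k) ≤ ‖multiDeriv α f c‖ := by
  have hd0 : (0 : ℝ) < d := by exact_mod_cast hd
  -- A cube of half-side `r / d` fits into the ball of radius `r`. Differentiating in one coordinate
  -- only leaves powers of `φ 0`, which is nonzero by the lower bound at order 0.
  obtain ⟨φ, hφ, hφ0, b, hb, hφb⟩ := exists_lineClass_bump hσ hA (div_pos hr hd0)
  have hs : ∀ i, ContDiff ℝ ∞ (fun t => φ (t - c i)) := fun i => (hφ.comp_sub_const _).contDiff
  have hφ1 : 0 < ‖φ 0‖ := by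
    refine lt_of_lt_of_le ?_ (hφb 0)
    have := pttSeq_pos (by linarith : σ ≠ 0) A 0
    positivity
  let i₀ : Fin d := ⟨0, hd⟩
  refine ⟨_, hφ.spaceClass_tensor hσ c, fun x hx => ?_,
    b * ∏ _i ∈ Finset.univ.erase i₀, ‖φ 0‖, by positivity, fun k =>
      ⟨Pi.single i₀ k, by simp [multiLength], ?_⟩⟩
  · contrapose! hx
    have hlt : ∀ i, ‖(x - c) i‖ ≤ r / d := fun i => by
      by_contra! h
      exact hx (Finset.prod_eq_zero (Finset.mem_univ i) (hφ0 _ (by simpa using h.le)))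
    rw [mem_closedBall_iff_norm, EuclideanSpace.norm_eq]
    have hd1 : (1 : ℝ) ≤ d := by exact_mod_cast hd
    refine Real.sqrt_le_iff.2 ⟨hr.le, ?_⟩
    calc ∑ i, ‖(x - c) i‖ ^ 2 ≤ ∑ _i : Fin d, (r / d) ^ 2 :=
          Finset.sum_le_sum fun i _ => pow_le_pow_left₀ (norm_nonneg _) (hlt i) 2
      _ = r ^ 2 / d := by
          simp
          field_simp
      _ ≤ r ^ 2 := div_le_self (by positivity) hd1
  · rw [multiDeriv_tensor hs, tensor, norm_prod,
      ← Finset.mul_prod_erase _ _ (Finset.mem_univ i₀)]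
    simp only [iteratedDeriv_comp_sub_const, sub_self, Pi.single_eq_same]
    have h : ∏ i ∈ Finset.univ.erase i₀,
        ‖iteratedDeriv ((Pi.single i₀ k : Fin d → ℕ) i) φ 0‖ =
          ∏ _i ∈ Finset.univ.erase i₀, ‖φ 0‖ := by
      refine Finset.prod_congr rfl fun i hi => ?_
      simp [Pi.single_eq_of_ne (Finset.ne_of_mem_erase hi)]
    rw [h, mul_right_comm]
    gcongr
    exact hφb k

/-- The unit gap between `τ` and `A` yields a factor `k^{k^σ}`. Since `k ≤ k^σ`, it dominates `2^k
h^{k^σ} (C/b + 1)` once `k ≥ 2h(C/b + 1)`. -/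
theorem exists_lt_pttSeq {σ τ A : ℝ} (hσ : 1 ≤ σ) (hA : τ + 1 ≤ A) {b h C : ℝ} (hb : 0 < b)
    (hh : 0 < h) (hC : 0 ≤ C) :
    ∃ k : ℕ, C * (h ^ ((k : ℝ) ^ σ) * pttSeq τ σ k) < b * ((1 / 2) ^ k * pttSeq A σ k) := by
  obtain ⟨k, hk⟩ := exists_nat_ge (max 1 (2 * h * (C / b + 1)))
  have hk1 : (1 : ℝ) ≤ k := (le_max_left _ _).trans hk
  have hk2 : 2 * h * (C / b + 1) ≤ k := (le_max_right _ _).trans hk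
  have hk0 : (0 : ℝ) < k := by linarith
  set s : ℝ := (k : ℝ) ^ σ with hs
  have hks : (k : ℝ) ≤ s := natCast_le_rpow hσ k
  have hCb : 1 ≤ C / b + 1 := by
    have : 0 ≤ C / b := by positivity
    linarith
  have h1 : (k : ℝ) ^ (τ * s) * (k : ℝ) ^ s ≤ (k : ℝ) ^ (A * s) := by
    rw [← Real.rpow_add hk0]
    refine Real.rpow_le_rpow_of_exponent_le hk1 ?_
    nlinarith
  have h2 : 2 ^ k * h ^ s * (C / b + 1) ≤ (k : ℝ) ^ s := by
    calc 2 ^ k * h ^ s * (C / b + 1) ≤ (2 : ℝ) ^ s * h ^ s * (C / b + 1) ^ s := by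
          gcongr
          · rw [← Real.rpow_natCast]
            exact Real.rpow_le_rpow_of_exponent_le (by norm_num) hks
          · exact Real.self_le_rpow_of_one_le hCb (hk1.trans hks)
      _ = (2 * h * (C / b + 1)) ^ s := by
          rw [Real.mul_rpow (by positivity) (by positivity), Real.mul_rpow (by norm_num) hh.le]
      _ ≤ _ := Real.rpow_le_rpow (by positivity) hk2 (by linarith)
  refine ⟨k, ?_⟩
  have hT : 0 < (k : ℝ) ^ (τ * s) := Real.rpow_pos_of_pos hk0 _
  have hH : 0 < h ^ s := Real.rpow_pos_of_pos hh _
  calc C * (h ^ s * pttSeq τ σ k) < (C + b) * (h ^ s * (k : ℝ) ^ (τ * s)) := by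
        rw [pttSeq]
        exact mul_lt_mul_of_pos_right (by linarith) (by positivity)
    _ = b * ((1 / 2) ^ k * ((k : ℝ) ^ (τ * s) * (2 ^ k * h ^ s * (C / b + 1)))) := by
        field_simp
        rw [← mul_pow]
        norm_num
    _ ≤ b * ((1 / 2) ^ k * ((k : ℝ) ^ (τ * s) * (k : ℝ) ^ s)) := by gcongr
    _ ≤ b * ((1 / 2) ^ k * pttSeq A σ k) := by
        rw [pttSeq]
        gcongr

/-! ### Locally finite sequences of balls in an open set -/

theorem exists_compact_exhaustion {X : Type*} [PseudoMetricSpace X] [ProperSpace X] [Nonempty X]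
    {U : Set X} (hU : IsOpen U) :
    ∃ K : ℕ → Set X, (∀ n, IsCompact (K n) ∧ K n ⊆ U) ∧
      ∀ L, IsCompact L → L ⊆ U → ∃ m, ∀ n, m ≤ n → L ⊆ K n := by
  obtain ⟨p⟩ := ‹Nonempty X›
  refine ⟨fun n => Metric.closedBall p n \ Metric.thickening (1 / ((n : ℝ) + 1)) Uᶜ,
    fun n => ⟨(isCompact_closedBall p _).diff Metric.isOpen_thickening, fun x hx => ?_⟩,
    fun L hL hLU => ?_⟩
  · by_contra h
    exact hx.2 (Metric.self_subset_thickening (by positivity) _ h)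
  · obtain ⟨δ, hδ, hδU⟩ := hL.exists_thickening_subset_open hU hLU
    obtain ⟨R, hR⟩ := hL.isBounded.subset_closedBall p
    obtain ⟨m, hm⟩ := exists_nat_gt (max R (1 / δ))
    refine ⟨m, fun n hn x hx => ?_⟩
    have hmn : (m : ℝ) ≤ n := by exact_mod_cast hn
    have hRn : R ≤ n := ((le_max_left _ _).trans hm.le).trans hmn
    have hδn : 1 / ((n : ℝ) + 1) ≤ δ := by
      rw [one_div_le (by positivity) hδ]
      linarith [le_max_right R (1 / δ)]
    refine ⟨Metric.closedBall_subset_closedBall hRn (hR hx), fun hx' => ?_⟩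
    obtain ⟨z, hz, hxz⟩ := Metric.mem_thickening_iff.1 hx'
    exact hz (hδU (Metric.mem_thickening_iff.2 ⟨x, hx, by
      rw [dist_comm]
      exact hxz.trans_le hδn⟩))

/-- If `U = L`, then `U` is clopen and nonempty, hence all of `ℝ^d` by connectedness, contradicting
noncompactness for `d ≥ 1`. -/
theorem exists_closedBall_subset_diff {d : ℕ} (hd : 1 ≤ d) {U L : Set (Space d)}
    (hU : IsOpen U) (hne : U.Nonempty) (hL : IsCompact L) (hLU : L ⊆ U) :
    ∃ (c : Space d) (r : ℝ), 0 < r ∧ Metric.closedBall c r ⊆ U \ L := by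
  have : Nonempty (Fin d) := ⟨⟨0, hd⟩⟩
  have hne' : (U \ L).Nonempty := by
    by_contra h
    have hUL : U = L := (Set.sdiff_eq_empty.1 (Set.not_nonempty_iff_eq_empty.1 h)).antisymm hLU
    have huniv : U = Set.univ :=
      IsClopen.eq_univ ⟨hUL ▸ hL.isClosed, hU⟩ hne
    exact noncompact_univ (Space d) (huniv ▸ hUL ▸ hL)
  obtain ⟨c, hc⟩ := hne'
  obtain ⟨r, hr, h⟩ := Metric.nhds_basis_closedBall.mem_iff.1
    ((hU.sdiff hL.isClosed).mem_nhds hc)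
  exact ⟨c, r, hr, h⟩

theorem exists_seq_closedBall {d : ℕ} (hd : 1 ≤ d) {U : Set (Space d)} (hU : IsOpen U)
    (hne : U.Nonempty) :
    ∃ (c : ℕ → Space d) (r : ℕ → ℝ), (∀ n, 0 < r n) ∧
      (∀ n, Metric.closedBall (c n) (r n) ⊆ U) ∧
      (∀ m n, m < n → Disjoint (Metric.closedBall (c m) (r m)) (Metric.closedBall (c n) (r n))) ∧
      ∀ L, IsCompact L → L ⊆ U → ∃ m, ∀ n, m ≤ n →
        Disjoint L (Metric.closedBall (c n) (r n)) := by
  obtain ⟨K, hK, hKL⟩ := exists_compact_exhaustion hU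
  have hb : ∀ L : {L : Set (Space d) // IsCompact L ∧ L ⊆ U}, ∃ p : Space d × ℝ,
      0 < p.2 ∧ Metric.closedBall p.1 p.2 ⊆ U \ L.1 := fun L => by
    obtain ⟨c, r, h⟩ := exists_closedBall_subset_diff hd hU hne L.2.1 L.2.2
    exact ⟨(c, r), h⟩
  choose p hp hpU using hb
  -- The compact set to avoid accumulates all balls chosen so far, for disjointness, and the
  -- exhaustion, for local finiteness.
  let L : ℕ → {L : Set (Space d) // IsCompact L ∧ L ⊆ U} := fun n =>
    Nat.rec ⟨K 0, hK 0⟩ (fun n L => ⟨L.1 ∪ Metric.closedBall (p L).1 (p L).2 ∪ K (n + 1),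
      (L.2.1.union (isCompact_closedBall _ _)).union (hK _).1,
      Set.union_subset (Set.union_subset L.2.2 ((hpU L).trans Set.sdiff_subset)) (hK _).2⟩) n
  have hLs : ∀ n, (L (n + 1)).1 =
      (L n).1 ∪ Metric.closedBall (p (L n)).1 (p (L n)).2 ∪ K (n + 1) := fun n => rfl
  have hmono : Monotone fun n => (L n).1 := monotone_nat_of_le_succ fun n => by
    rw [hLs]
    exact Set.subset_union_left.trans Set.subset_union_left
  have hKn : ∀ n, K n ⊆ (L n).1 := fun n => by
    cases n with
    | zero => exact subset_rfl
    | succ n =>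
      rw [hLs]
      exact Set.subset_union_right
  have hdisj : ∀ n, Disjoint (L n).1 (Metric.closedBall (p (L n)).1 (p (L n)).2) := fun n =>
    (Set.subset_sdiff.1 (hpU (L n))).2.symm
  refine ⟨fun n => (p (L n)).1, fun n => (p (L n)).2, fun n => hp _,
    fun n => (hpU _).trans Set.sdiff_subset, fun m n hmn => ?_, fun M hM hMU => ?_⟩
  · refine (hdisj n).mono_left (le_trans ?_ (hmono (Nat.succ_le_of_lt hmn)))
    simp only [hLs]
    exact Set.subset_union_right.trans Set.subset_union_left
  · obtain ⟨m, hm⟩ := hKL M hM hMU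
    exact ⟨m, fun n hn => (hdisj n).mono_left ((hm n hn).trans (hKn n))⟩

/-- A locally finite sum of functions with disjoint supports agrees with a partial sum near any
compact set. -/
theorem exists_eventuallyEq_sum {d : ℕ} {U : Set (Space d)} (hU : IsOpen U)
    {f : ℕ → Space d → ℂ} {B : ℕ → Set (Space d)} (hf : ∀ n, ∀ x ∉ B n, f n x = 0)
    (hB : ∀ L, IsCompact L → L ⊆ U → ∃ m, ∀ n, m ≤ n → Disjoint L (B n))
    {K : Set (Space d)} (hK : IsCompact K) (hKU : K ⊆ U) :
    ∃ m, ∀ x ∈ K, (fun y => ∑' n, f n y) =ᶠ[nhds x] ∑ n ∈ Finset.range m, f n := by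
  obtain ⟨L, hL, hKL, hLU⟩ := exists_compact_between hK hU hKU
  obtain ⟨m, hm⟩ := hB L hL hLU
  refine ⟨m, fun x hx => ?_⟩
  filter_upwards [mem_interior_iff_mem_nhds.1 (hKL hx)] with y hy
  rw [Finset.sum_apply]
  refine tsum_eq_sum fun n hn => hf n y ?_
  exact Set.disjoint_left.1 (hm n (by simpa using hn)) hy

end PTT

end

theorem mainTheorem12 (d : ℕ) (hd : 1 ≤ d)
    (U : Set (PTT.Space d)) (hUo : IsOpen U) (hUne : U.Nonempty)
    (σ : ℝ) (hσ : 1 ≤ σ)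
    (N : PTT.WeightMatrix) (hlc : N.StandardLogConvex) (hnq : N.NonQuasianalytic)
    (hsub : PTT.pttLimitClass σ U ⊆ PTT.roumieuClass N U) :
    PTT.pttLimitClass σ U ⊂ PTT.roumieuClass N U := by
  obtain ⟨c, r, hr, hBU, hdisj, hfin⟩ := PTT.exists_seq_closedBall hd hUo hUne
  -- The rate `n + 1` exceeds any `τ ≤ n` by the required unit gap.
  choose f hf hf0 b hb hlow using fun n : ℕ => PTT.exists_spaceClass_bump hd (A := (n : ℝ) + 1) hσ
    (by positivity) (c n) (hr n)
  have hloc := fun {K} => PTT.exists_eventuallyEq_sum hUo hf0 hfin (K := K)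
  have hsum : ∀ m, PTT.SpaceClass σ (∑ n ∈ Finset.range m, f n) := fun m =>
    PTT.SpaceClass.sum (by linarith) _ hf
  refine (Set.ssubset_iff_of_subset hsub).2 ⟨fun y => ∑' n, f n y, ⟨fun x hx => ?_,
    fun K hK hKU => ?_⟩, ?_⟩
  · obtain ⟨m, hm⟩ := hloc isCompact_singleton (Set.singleton_subset_iff.2 hx)
    exact ((hsum m).contDiff.contDiffAt.congr_of_eventuallyEq
      (hm x rfl)).contDiffWithinAt
  · obtain ⟨m, hm⟩ := hloc hK hKU
    -- The inclusion is applied to the partial sum, which has the same germs as the full sum along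
    -- `K`.
    obtain ⟨x, h, hh, hlt⟩ := (hsub ((hsum m).mem_pttLimitClass hσ U)).2 K hK hKU
    exact ⟨x, h, hh, (PTT.weightSeminorm_congr _ _ h hm).trans_lt hlt⟩
  · rintro ⟨τ, -, -, hτ⟩
    obtain ⟨n, hn⟩ := exists_nat_ge τ
    have hcn : c n ∈ Metric.closedBall (c n) (r n) := Metric.mem_closedBall_self (hr n).le
    -- A single point suffices as compact set, because `τ` was fixed before it and the lower bounds
    -- hold at the centre.
    obtain ⟨h, hh, hlt⟩ := hτ {c n} isCompact_singleton (Set.singleton_subset_iff.2 (hBU n hcn))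
    obtain ⟨C, hC, hup⟩ := (PTT.weightSeminorm_lt_top_iff
      (PTT.pttSeq_pos (by linarith) τ) hh _ _).1 hlt
    obtain ⟨k, hk⟩ := PTT.exists_lt_pttSeq hσ (by linarith : τ + 1 ≤ (n : ℝ) + 1) (hb n) hh hC
    obtain ⟨α, rfl, hα⟩ := hlow n k
    have heq : (fun y => ∑' n, f n y) =ᶠ[nhds (c n)] f n := by
      filter_upwards [Metric.closedBall_mem_nhds (c n) (hr n)] with y hy
      refine tsum_eq_single n fun m hmn => hf0 m y fun hym => ?_
      rcases lt_or_gt_of_ne hmn with h | h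
      · exact Set.disjoint_left.1 (hdisj m n h) hym hy
      · exact Set.disjoint_left.1 (hdisj n m h) hy hym
    have := hup α (c n) rfl
    rw [(heq.multiDeriv α).eq_of_nhds] at this
    linarith
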